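/- Let $G$ be a group (finite or infinite). Let $\mathcal{C}(G)$ be its coset poset: the set of all left cosets $xH$ ($x \in G$) of all proper subgroups $H$ of $G$, ordered by inclusion. Let $\Delta(\mathcal{C}(G))$ be its order complex, i.e. the simplicial complex whose simplices are the nonempty finite chains of $\mathcal{C}(G)$; let $|\mathcal{C}(G)|$ be the geometric realization of this complex (with the weak topology) and $H_1(\mathcal{C}(G))$ its first simplicial homology group with coefficients in $\mathbb{Z}$. **Theorem.** Suppose that $G$ is not cyclic and that $G$ has a maximal subgroup $M$ which is cyclic of prime-power order $p^n$ ($p$ prime). Then the rank of the abelian group $H_1(\mathcal{C}(G))$ is at least $(p-1)\cdot (G:M)$, where $(G:M)$ is the index of $M$ in $G$ (the cardinality of $G/M$); moreover, if $G$ is infinite, then $H_1(\mathcal{C}(G))$ has infinite rank. In particular, $|\mathcal{C}(G)|$ is not simply connected. -/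

import Mathlib

open scoped Pointwise

/-! ### The coset poset -/

/-- The coset poset of a group `G`: all left cosets `x • H` of all proper subgroups `H` of `G`,
as subsets of `G`, ordered by inclusion (the order inherited from `Set G`). -/
abbrev CosetPoset (G : Type*) [Group G] : Type _ :=
  {S : Set G // ∃ (H : Subgroup G) (x : G), H ≠ ⊤ ∧ S = x • (H : Set G)}

/-! ### The order complex and geometric realization -/

/-- The order complex of a poset `P`: its simplices are the nonempty finite chains of `P`. -/
def orderComplex (P : Type*) [PartialOrder P] : AbstractSimplicialComplex P where
  faces := {s | s.Nonempty ∧ IsChain (· ≤ ·) (s : Set P)}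
  isRelLowerSet_faces := fun _ hs =>
    ⟨hs.1, fun _ hts ht => ⟨ht, hs.2.mono (Finset.coe_subset.mpr hts)⟩⟩
  singleton_mem := fun v => ⟨Finset.singleton_nonempty v, by simp⟩

/-- The points of the geometric realization of an abstract simplicial complex `K` on the vertex
set `V`, in barycentric coordinates: formal convex combinations of vertices of `K` whose support
is a simplex of `K`. -/
structure GeometricRealization {V : Type*} (K : AbstractSimplicialComplex V) where
  /-- the barycentric coordinates -/
  coord : V →₀ ℝ
  nonneg : ∀ v, 0 ≤ coord v
  sum_eq_one : ∑ v ∈ coord.support, coord v = 1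
  support_mem : coord.support ∈ K

namespace GeometricRealization

variable {V : Type*} (K : AbstractSimplicialComplex V)

/-- The closed simplex of the realization spanned by a finite set `s` of vertices. -/
def closedSimplex (s : Finset V) : Set (GeometricRealization K) :=
  {x | x.coord.support ⊆ s}

/-- The Euclidean topology on a closed simplex, i.e. the topology of coordinatewise convergence
(all coordinates outside the finite set `s` vanish). -/
abbrev closedSimplexTopology (s : Finset V) : TopologicalSpace (closedSimplex K s) :=
  TopologicalSpace.induced (fun x => (fun v => x.1.coord v : V → ℝ)) inferInstance

/-- The weak topology: a set is open if and only if its intersection with each closed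
simplex of `K` is open in the Euclidean topology of that simplex. -/
instance : TopologicalSpace (GeometricRealization K) :=
  ⨆ s : {s : Finset V // s ∈ K},
    TopologicalSpace.coinduced (Subtype.val : closedSimplex K s.1 → GeometricRealization K)
      (closedSimplexTopology K s.1)

end GeometricRealization

/-! ### Simplicial homology of the order complex with integer coefficients -/

namespace OrderComplex

variable (P : Type*) [PartialOrder P]

/-- The group of simplicial `n`-chains of the order complex of `P`: the free abelian group on the
`n`-simplices, i.e. on the chains `p₀ < p₁ < ⋯ < pₙ` of `P`, each oriented by its order. -/
abbrev Chains (n : ℕ) : Type _ := (Fin (n + 1) ↪o P) →₀ ℤ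

variable {P} in
/-- The `i`-th face `p₀ < ⋯ < pᵢ₋₁ < pᵢ₊₁ < ⋯ < pₙ₊₁` of a simplex. -/
def face {n : ℕ} (σ : Fin (n + 2) ↪o P) (i : Fin (n + 2)) : Fin (n + 1) ↪o P :=
  (Fin.succAboveOrderEmb i).trans σ

/-- The simplicial boundary map, `∂ σ = ∑ᵢ (-1)ⁱ σ_i` where `σ_i` is the `i`-th face of `σ`. -/
noncomputable def boundary (n : ℕ) : Chains P (n + 1) →ₗ[ℤ] Chains P n :=
  Finsupp.linearCombination ℤ fun σ : Fin (n + 2) ↪o P =>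
    ∑ i : Fin (n + 2), (-1 : ℤ) ^ (i : ℕ) • Finsupp.single (face σ i) (1 : ℤ)

theorem boundary_single {n : ℕ} (σ : Fin (n + 2) ↪o P) :
    boundary P n (Finsupp.single σ 1) =
      ∑ i : Fin (n + 2), (-1 : ℤ) ^ (i : ℕ) • Finsupp.single (face σ i) (1 : ℤ) := by
  simp [boundary, Finsupp.linearCombination_single]

theorem boundary_comp_boundary (n : ℕ) : boundary P n ∘ₗ boundary P (n + 1) = 0 := by
  ext1 σ
  refine LinearMap.ext_ring ?_
  simp only [LinearMap.comp_apply, Finsupp.lsingle_apply, boundary_single, map_sum, map_smul,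
    LinearMap.zero_apply]
  simp only [Finset.smul_sum, smul_smul, ← Finset.sum_product', Finset.univ_product_univ]
  let S : Finset (Fin (n + 3) × Fin (n + 2)) := {ij | (ij.1 : ℕ) ≤ (ij.2 : ℕ)}
  rw [← Finset.sum_add_sum_compl S, ← eq_neg_iff_add_eq_zero, ← Finset.sum_neg_distrib]
  refine Finset.sum_bij (fun ij hij => (ij.2.succ, Fin.castLT ij.1
    (lt_of_le_of_lt (Finset.mem_filter.mp hij).2 ij.2.is_lt))) ?_ ?_ ?_ ?_
  · rintro ⟨i, j⟩ hij
    simp [S] at hij ⊢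
    omega
  · rintro ⟨i, j⟩ hij ⟨i', j'⟩ hij' h
    simp only [Prod.mk.injEq, Fin.ext_iff, Fin.val_succ, Fin.val_castLT] at h ⊢
    omega
  · rintro ⟨i, j⟩ hij
    simp [S] at hij
    refine ⟨(j.castSucc, i.pred ?_), ?_, ?_⟩
    · rintro rfl
      simp at hij
    · simp [S]
      omega
    · simp
  · rintro ⟨i, j⟩ hij
    simp [S] at hij
    rw [← neg_smul]
    congr 1
    · simp only [Fin.val_succ, Fin.val_castLT, pow_succ]
      ring
    · congr 1
      ext k
      simp only [face, RelEmbedding.coe_trans, Function.comp_apply, Fin.succAboveOrderEmb_apply]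
      congr 1
      simp only [Fin.ext_iff, Fin.succAbove, Fin.lt_def]
      split_ifs <;> simp_all <;> omega

/-- The group of simplicial `n`-cycles. -/
noncomputable def cycles : (n : ℕ) → Submodule ℤ (Chains P n)
  | 0 => ⊤
  | n + 1 => LinearMap.ker (boundary P n)

/-- The simplicial homology group `Hₙ` of the order complex of `P` with coefficients in `ℤ`:
the `n`-cycles modulo the boundaries of `(n + 1)`-chains. -/
abbrev Homology (n : ℕ) : Type _ :=
  cycles P n ⧸ (LinearMap.range (boundary P n)).submoduleOf (cycles P n)

end OrderComplex

/-!
Let `K` be the subgroup of index `p` in `M`; it contains all proper subgroups of `M`. The cosets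
`u • M` are maximal elements of the coset poset `C`, and every coset properly contained in `u • M`
lies in exactly one of the `p` cosets of `K` in `u • M`. Thus the part of `C` strictly below `u • M`
has `p` components, one for each of these cosets of `K` (`CosetPoset.isBelowComponent_coset`).

On the other hand, `C` remains connected when all cosets of `M` are removed
(`CosetPoset.zigzagOff_of_notMem`): for `k ∉ M` the points `x` and `x * k` lie in the coset
`x • ⟨k⟩`, where `⟨k⟩` is proper because `G` is not cyclic, and the complement of `M` generates `G`.

Putting `u • M` back amounts to attaching a cone over `p` components which are already connected to
each other, and this creates `p - 1` independent `1`-cycles. To see the independence, attach to each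
component `A` below a maximal element `m` the `1`-cochain with value `1` on the edges `a < m`,
`a ∈ A`, and value `0` elsewhere. It is a cocycle (`OrderComplex.linkCochain_comp_boundary`). With
one component left out for each coset of `M`, these cocycles are dual to the family of cycles
(`OrderComplex.mk_prod_le_rank_homology_one`). If `G` is infinite, then so is `G ⧸ M`, since `M` is
finite.

Geometrically the cocycle is a continuous map from the realization to the circle,
`GeometricRealization.linkMap`. Two paths with the same endpoints whose images in the circle lift
to paths in `ℝ` from `0` to `1` and from `0` to `0` are not homotopic, so the realization is not
simply connected (`GeometricRealization.not_simplyConnectedSpace_of_zigzagOff`).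
-/

/-! ### Chains of a poset that is connected away from a set of maximal elements -/

section Poset

universe u v w

variable {P : Type*} [PartialOrder P]

/-- `a` and `b` are joined by a zigzag in the comparability graph of `P`, none of whose steps has
its upper end in `D`. When all elements of `D` are maximal, this says that the zigzag stays in the
complement of `D`. -/
def ZigzagOff (D : Set P) : P → P → Prop :=
  Relation.EqvGen fun a b => a < b ∧ b ∉ D

/-- `A` is a union of connected components of the part of `P` strictly below `m`. -/
def IsBelowComponent (m : P) (A : Set P) : Prop :=
  ∀ ⦃a b : P⦄, a ≤ b → b < m → (a ∈ A ↔ b ∈ A)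

namespace OrderComplex

/-- The `0`-simplex of the order complex at `a`. -/
def vertex (a : P) : Fin 1 ↪o P :=
  OrderEmbedding.ofStrictMono ![a] (Subsingleton.strictMono _)

/-- The `1`-simplex `a < b` of the order complex. -/
def edge {a b : P} (h : a < b) : Fin 2 ↪o P :=
  OrderEmbedding.ofStrictMono ![a, b] (by
    intro i j hij
    fin_cases i <;> fin_cases j <;> simp_all)

theorem boundary_edge {a b : P} (h : a < b) :
    boundary P 0 (Finsupp.single (edge h) 1) =
      Finsupp.single (vertex b) 1 - Finsupp.single (vertex a) 1 := by
  have h0 : face (edge h) 0 = vertex b := by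
    ext i; fin_cases i; rfl
  have h1 : face (edge h) 1 = vertex a := by
    ext i; fin_cases i; rfl
  rw [boundary_single, Fin.sum_univ_two, h0, h1]
  simp [sub_eq_add_neg]

theorem boundary_triangle (σ : Fin 3 ↪o P) :
    boundary P 1 (Finsupp.single σ 1) = Finsupp.single (face σ 0) 1 -
      Finsupp.single (face σ 1) 1 + Finsupp.single (face σ 2) 1 := by
  rw [boundary_single]
  refine (Fin.sum_univ_three _).trans ?_
  simp [sub_eq_add_neg]

/-- A zigzag away from `D` is realized by a `1`-chain supported on edges away from `D`. -/
theorem exists_chain_of_zigzagOff {D : Set P} {a b : P} (h : ZigzagOff D a b) :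
    ∃ w : Chains P 1, boundary P 0 w = Finsupp.single (vertex b) 1 - Finsupp.single (vertex a) 1 ∧
      w ∈ Finsupp.supported ℤ ℤ {σ : Fin 2 ↪o P | σ 1 ∉ D} := by
  induction h with
  | rel a b h =>
    exact ⟨_, boundary_edge h.1, Finsupp.single_mem_supported _ _ h.2⟩
  | refl a => exact ⟨0, by simp, zero_mem _⟩
  | symm a b _ ih =>
    obtain ⟨w, hw, hD⟩ := ih
    exact ⟨-w, by rw [map_neg, hw, neg_sub], neg_mem hD⟩
  | trans a b c _ _ ih₁ ih₂ =>
    obtain ⟨v, hv, hvD⟩ := ih₁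
    obtain ⟨w, hw, hwD⟩ := ih₂
    exact ⟨w + v, by rw [map_add, hv, hw, sub_add_sub_cancel], add_mem hwD hvD⟩

open Classical in
/-- The `1`-cochain of the order complex which is `1` on the edges `a < m` with `a ∈ A` and `0` on
all other edges. -/
noncomputable def linkCochain (m : P) (A : Set P) : Chains P 1 →ₗ[ℤ] ℤ :=
  Finsupp.linearCombination ℤ fun σ : Fin 2 ↪o P => if σ 1 = m ∧ σ 0 ∈ A then 1 else 0

open Classical in
theorem linkCochain_single (m : P) (A : Set P) (σ : Fin 2 ↪o P) :
    linkCochain m A (Finsupp.single σ 1) = if σ 1 = m ∧ σ 0 ∈ A then 1 else 0 := by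
  simp [linkCochain, Finsupp.linearCombination_single]

open Classical in
theorem linkCochain_edge (m : P) (A : Set P) {a b : P} (h : a < b) :
    linkCochain m A (Finsupp.single (edge h) 1) = if b = m ∧ a ∈ A then 1 else 0 :=
  linkCochain_single m A (edge h)

theorem linkCochain_eq_zero_of_mem_supported {D : Set P} {m : P} (hm : m ∈ D) (A : Set P)
    {w : Chains P 1} (hw : w ∈ Finsupp.supported ℤ ℤ {σ : Fin 2 ↪o P | σ 1 ∉ D}) :
    linkCochain m A w = 0 := by
  rw [linkCochain, Finsupp.linearCombination_apply, Finsupp.sum]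
  refine Finset.sum_eq_zero fun σ hσ => ?_
  have hσD : σ 1 ∉ D := (Finsupp.mem_supported _ _).1 hw hσ
  have hne : ¬ (σ 1 = m ∧ σ 0 ∈ A) := fun h => hσD (h.1 ▸ hm)
  simp [hne]

open Classical in
/-- On a triangle `a < b < m` the cochain takes equal values on `a < m` and `b < m`. On any other
triangle it vanishes on each side, because `m` is maximal. -/
theorem linkCochain_comp_boundary {m : P} (hm : IsMax m) {A : Set P} (hA : IsBelowComponent m A) :
    linkCochain m A ∘ₗ boundary P 1 = 0 := by
  ext1 σ
  refine LinearMap.ext_ring ?_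
  have h01 : σ 0 < σ 1 := σ.strictMono (by decide)
  have h12 : σ 1 < σ 2 := σ.strictMono (by decide)
  have h1m : σ 1 ≠ m := fun h => hm.not_lt (h ▸ h12)
  change linkCochain m A (boundary P 1 (Finsupp.single σ 1)) = 0
  rw [boundary_triangle, map_add, map_sub, linkCochain_single, linkCochain_single,
    linkCochain_single]
  change (if σ 2 = m ∧ σ 1 ∈ A then 1 else 0) - (if σ 2 = m ∧ σ 0 ∈ A then 1 else 0) +
    (if σ 1 = m ∧ σ 0 ∈ A then 1 else 0) = (0 : ℤ)
  by_cases h2 : σ 2 = m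
  · have := hA h01.le (h2 ▸ h12)
    simp [h2, h1m, this]
  · simp [h2, h1m]

/-- The functional on `H₁` defined by the cocycle `linkCochain m A`. -/
noncomputable def linkFunctional {m : P} (hm : IsMax m) {A : Set P} (hA : IsBelowComponent m A) :
    Homology P 1 →ₗ[ℤ] ℤ :=
  Submodule.liftQ _ (linkCochain m A ∘ₗ (cycles P 1).subtype) (by
    rintro ⟨z, hz⟩ ⟨w, rfl⟩
    exact LinearMap.congr_fun (linkCochain_comp_boundary hm hA) w)

open Classical in
/-- Let `D` be a set of maximal elements of `P`, and suppose that below each `m x ∈ D` there are a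
base element `a₀ x` and elements `a x j` in pairwise different components, all of which can be
joined to each other away from `D`. Joining `a x j` to `a₀ x` once through `m x` and once away from
`D` gives a `1`-cycle, and the functionals of the components form a dual family to these cycles. -/
theorem mk_prod_le_rank_homology_one {P : Type u} [PartialOrder P] {ι : Type v} {J : Type w}
    {D : Set P} (hD : ∀ m ∈ D, IsMax m) (m : ι → P) (hm : ∀ x, m x ∈ D) (hinj : Function.Injective m)
    (A : ι → J → Set P) (hA : ∀ x j, IsBelowComponent (m x) (A x j))
    (a₀ : ι → P) (ha₀ : ∀ x, a₀ x < m x) (ha₀A : ∀ x j, a₀ x ∉ A x j)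
    (a : ι → J → P) (ha : ∀ x j, a x j < m x) (haA : ∀ x j k, a x j ∈ A x k ↔ j = k)
    (hconn : ∀ x j, ZigzagOff D (a x j) (a₀ x)) :
    Cardinal.lift.{u} (Cardinal.mk (ι × J)) ≤
      Cardinal.lift.{max v w} (Module.rank ℤ (Homology P 1)) := by
  choose w hw hwD using fun x j => exists_chain_of_zigzagOff (hconn x j)
  let z : ι × J → Chains P 1 := fun i =>
    Finsupp.single (edge (ha i.1 i.2)) 1 - Finsupp.single (edge (ha₀ i.1)) 1 - w i.1 i.2
  have hz : ∀ i, z i ∈ cycles P 1 := fun i => by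
    change boundary P 0 (z i) = 0
    simp only [z, map_sub, boundary_edge, hw]
    abel
  let v : ι × J → Homology P 1 := fun i => Submodule.Quotient.mk ⟨z i, hz i⟩
  let f : ι × J → Module.Dual ℤ (Homology P 1) := fun i =>
    linkFunctional (hD _ (hm i.1)) (hA i.1 i.2)
  have hfv : ∀ i k, f i (v k) = if m k.1 = m i.1 ∧ a k.1 k.2 ∈ A i.1 i.2 then 1 else 0 := by
    intro i k
    change linkCochain (m i.1) (A i.1 i.2) (z k) = _
    have h0 : ¬ (m k.1 = m i.1 ∧ a₀ k.1 ∈ A i.1 i.2) := fun h => by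
      rw [hinj h.1] at h
      exact ha₀A _ _ h.2
    simp only [z, map_sub, linkCochain_edge, h0, if_false,
      linkCochain_eq_zero_of_mem_supported (hm i.1) _ (hwD k.1 k.2), sub_zero]
  have hli : LinearIndependent ℤ v := by
    refine LinearIndependent.of_pairwise_dual_eq_zero_one v f ?_ ?_
    · rintro ⟨x, j⟩ ⟨y, k⟩ hne
      rw [hfv, if_neg]
      rintro ⟨h₁, h₂⟩
      obtain rfl := hinj h₁
      exact hne (Prod.ext rfl ((haA _ _ _).1 h₂).symm)
    · intro i
      rw [hfv, if_pos ⟨rfl, (haA _ _ _).2 rfl⟩]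
  exact hli.cardinal_lift_le_rank

end OrderComplex

end Poset

/-! ### Paths in the geometric realization -/

namespace GeometricRealization

section Complex

variable {V : Type*} {K : AbstractSimplicialComplex V}

/-- A map out of the realization is continuous if it is continuous on each closed simplex. -/
theorem continuous_of_closedSimplex {Y : Type*} [TopologicalSpace Y]
    {f : GeometricRealization K → Y}
    (h : ∀ s ∈ K, @Continuous _ _ (closedSimplexTopology K s) _
      fun x : closedSimplex K s => f x) : Continuous f :=
  continuous_iSup_dom.2 fun s => continuous_coinduced_dom.2 (h s.1 s.2)

theorem continuous_closedSimplex_coord (s : Finset V) (v : V) :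
    @Continuous _ _ (closedSimplexTopology K s) _
      fun x : closedSimplex K s => x.1.coord v :=
  let _ := closedSimplexTopology K s
  (continuous_apply v).comp continuous_induced_dom

/-- A map into a closed simplex is continuous if all its barycentric coordinates are. -/
theorem continuous_of_coord {Y : Type*} [TopologicalSpace Y] {f : Y → GeometricRealization K}
    {s : Finset V} (hs : s ∈ K) (hfs : ∀ y, (f y).coord.support ⊆ s)
    (h : ∀ v, Continuous fun y => (f y).coord v) : Continuous f := by
  let _ := closedSimplexTopology K s
  have h₁ : Continuous fun y => (⟨f y, hfs y⟩ : closedSimplex K s) :=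
    continuous_induced_rng.2 (continuous_pi h)
  have h₂ : Continuous (Subtype.val : closedSimplex K s → GeometricRealization K) :=
    continuous_iSup_rng (i := (⟨s, hs⟩ : {s : Finset V // s ∈ K})) continuous_coinduced_rng
  exact h₂.comp h₁

theorem support_single_add_single_subset [DecidableEq V] (a b : V) (s t : ℝ) :
    (Finsupp.single a s + Finsupp.single b t).support ⊆ {a, b} :=
  Finsupp.support_add.trans (Finset.union_subset_union Finsupp.support_single_subset
    Finsupp.support_single_subset)

theorem sum_single_add_single (a b : V) (s t : ℝ) :
    ∑ v ∈ (Finsupp.single a s + Finsupp.single b t).support,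
      (Finsupp.single a s + Finsupp.single b t) v = s + t := by
  change Finsupp.sum _ (fun _ r => r) = s + t
  rw [Finsupp.sum_add_index' (fun _ => rfl) (fun _ _ _ => rfl), Finsupp.sum_single_index rfl,
    Finsupp.sum_single_index rfl]

/-- The point `(1 - t) a + t b` of the edge `{a, b}`. -/
noncomputable def edgePoint [DecidableEq V] {a b : V} (hab : {a, b} ∈ K) (t : unitInterval) :
    GeometricRealization K where
  coord := Finsupp.single a (1 - t : ℝ) + Finsupp.single b (t : ℝ)
  nonneg v := by
    have := t.2.1
    have := sub_nonneg.2 t.2.2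
    classical
    rw [Finsupp.add_apply, Finsupp.single_apply, Finsupp.single_apply]
    split_ifs <;> simp_all
  sum_eq_one := by rw [sum_single_add_single, sub_add_cancel]
  support_mem := by
    refine (K.isRelLowerSet_faces hab).2 (support_single_add_single_subset a b _ _) ?_
    refine Finset.nonempty_of_sum_ne_zero (f := ⇑(Finsupp.single a (1 - t : ℝ) +
      Finsupp.single b (t : ℝ))) ?_
    rw [sum_single_add_single, sub_add_cancel]
    exact one_ne_zero

/-- The vertex `a` as a point of the realization. -/
noncomputable def vertexPoint (K : AbstractSimplicialComplex V) (a : V) :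
    GeometricRealization K where
  coord := Finsupp.single a 1
  nonneg v := by
    classical
    rw [Finsupp.single_apply]
    split_ifs <;> simp
  sum_eq_one := by
    change Finsupp.sum _ (fun _ r => r) = (1 : ℝ)
    rw [Finsupp.sum_single_index rfl]
  support_mem := by
    have h : (Finsupp.single a (1 : ℝ)).support = {a} := by simp
    exact h ▸ K.singleton_mem a

theorem ext_coord {x y : GeometricRealization K} (h : x.coord = y.coord) : x = y := by
  cases x; cases y; cases h; rfl

/-- The path from `a` to `b` along the edge `{a, b}`. -/
noncomputable def edgePath [DecidableEq V] {a b : V} (hab : {a, b} ∈ K) :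
    Path (vertexPoint K a) (vertexPoint K b) where
  toFun := edgePoint hab
  continuous_toFun := by
    refine continuous_of_coord hab (fun t => support_single_add_single_subset a b _ _) fun v => ?_
    simp only [edgePoint, Finsupp.add_apply, Finsupp.single_apply]
    split_ifs <;> fun_prop
  source' := ext_coord (by simp [edgePoint, vertexPoint])
  target' := ext_coord (by simp [edgePoint, vertexPoint])

end Complex

section Poset

variable {P : Type*} [PartialOrder P]

theorem pair_mem_orderComplex [DecidableEq P] {a b : P} (h : a < b) :
    ({a, b} : Finset P) ∈ orderComplex P := by
  refine ⟨⟨a, by simp⟩, ?_⟩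
  rw [Finset.coe_pair]
  exact IsChain.pair h.le

open Classical in
/-- The map to the circle `ℝ / ℤ` which wraps each edge from an element of `A` below `m` to `m`
once around the circle: it takes the barycentric coordinate at `m` on all simplices with a vertex
in `A` below `m`, and is `0` on the others. -/
noncomputable def linkMap (m : P) (A : Set P) (x : GeometricRealization (orderComplex P)) :
    AddCircle (1 : ℝ) :=
  if ∃ a ∈ x.coord.support, a < m ∧ a ∈ A then ((x.coord m : ℝ) : AddCircle (1 : ℝ)) else 0

theorem linkMap_eq_zero (m : P) (A : Set P) {x : GeometricRealization (orderComplex P)}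
    (h : x.coord m = 0) : linkMap m A x = 0 := by
  simp [linkMap, h]

theorem linkMap_continuous {m : P} (hm : IsMax m) {A : Set P} (hA : IsBelowComponent m A) :
    Continuous (linkMap m A) := by
  refine continuous_of_closedSimplex fun s hs => ?_
  let _ := closedSimplexTopology (orderComplex P) s
  by_cases h : ∃ a ∈ s, a < m ∧ a ∈ A
  · obtain ⟨a, has, ham, haA⟩ := h
    suffices ∀ x : closedSimplex (orderComplex P) s,
        linkMap m A x.1 = ((x.1.coord m : ℝ) : AddCircle (1 : ℝ)) by
      simp only [this]
      exact (AddCircle.continuous_mk' 1).comp (continuous_closedSimplex_coord s m)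
    rintro ⟨x, hx⟩
    rw [linkMap]
    split_ifs with hex
    · rfl
    · -- All vertices of `s` below `m` lie in `A` and `m` is maximal, so `x` can have no other
      -- vertex than `m`, where the coordinate is `1`, unless its coordinate at `m` is `0`.
      by_cases hxm : x.coord m = 0
      · rw [hxm, AddCircle.coe_zero]
      have hsupp : x.coord.support = {m} := by
        refine Finset.eq_singleton_iff_unique_mem.2 ⟨Finsupp.mem_support_iff.2 hxm, ?_⟩
        intro b hb
        by_contra hbm
        have hms : m ∈ s := hx (Finsupp.mem_support_iff.2 hxm)
        have hlt : b < m := by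
          rcases hs.2 (hx hb) hms hbm with h | h
          · exact lt_of_le_of_ne h hbm
          · exact absurd (lt_of_le_of_ne h (Ne.symm hbm)) hm.not_lt
        refine hex ⟨b, hb, hlt, ?_⟩
        rcases eq_or_ne a b with rfl | hab
        · exact haA
        rcases hs.2 has (hx hb) hab with h | h
        · exact (hA h hlt).1 haA
        · exact (hA h ham).2 haA
      have h1 := x.sum_eq_one
      rw [hsupp, Finset.sum_singleton] at h1
      rw [h1, AddCircle.coe_period]
  · suffices ∀ x : closedSimplex (orderComplex P) s, linkMap m A x.1 = 0 by
      simp only [this]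
      exact continuous_const
    rintro ⟨x, hx⟩
    exact if_neg fun ⟨a, ha, h'⟩ => h ⟨a, hx ha, h'⟩

/-- The edge `a < b` is contained in the fibre of `linkMap m A` over `0` unless it joins an
element of `A` to `m`. -/
theorem joinedIn_edge {m : P} (A : Set P) {a b : P} (h : a < b) (ham : a ≠ m)
    (hb : b = m → a ∉ A) :
    JoinedIn {x | linkMap m A x = 0}
      (vertexPoint (orderComplex P) a) (vertexPoint (orderComplex P) b) := by
  classical
  refine ⟨edgePath (pair_mem_orderComplex h), fun t => ?_⟩
  by_cases hbm : b = m
  · refine if_neg ?_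
    rintro ⟨c, hc, hcm, hcA⟩
    have hc' := support_single_add_single_subset a b _ _ hc
    rw [Finset.mem_insert, Finset.mem_singleton] at hc'
    rcases hc' with rfl | rfl
    · exact hb hbm hcA
    · exact hcm.ne hbm
  · exact linkMap_eq_zero m A (by simp [edgePath, edgePoint, ham, hbm])

theorem joinedIn_of_zigzagOff {D : Set P} (hD : ∀ m ∈ D, IsMax m) {m : P} (hm : m ∈ D) (A : Set P)
    {a b : P} (h : ZigzagOff D a b) :
    JoinedIn {x | linkMap m A x = 0}
      (vertexPoint (orderComplex P) a) (vertexPoint (orderComplex P) b) := by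
  induction h with
  | rel a b h =>
    refine joinedIn_edge A h.1 (fun e => (hD m hm).not_lt (e ▸ h.1)) fun e => absurd hm (e ▸ h.2)
  | refl a =>
    refine JoinedIn.refl ?_
    by_cases h : a = m
    · subst h
      change linkMap _ _ _ = 0
      rw [linkMap]
      split_ifs
      · simp [vertexPoint]
      · rfl
    · exact linkMap_eq_zero m A (by simp [vertexPoint, h])
  | symm a b _ ih => exact ih.symm
  | trans a b c _ _ ih₁ ih₂ => exact ih₁.trans ih₂

theorem linkMap_edgePath [DecidableEq P] {m : P} {A : Set P} {a : P} (ham : a < m) (haA : a ∈ A)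
    (t : unitInterval) :
    linkMap m A (edgePath (pair_mem_orderComplex ham) t) = ((t : ℝ) : AddCircle (1 : ℝ)) := by
  have hm : (edgePath (pair_mem_orderComplex ham) t).coord m = t := by
    simp [edgePath, edgePoint, ham.ne]
  have ha : (edgePath (pair_mem_orderComplex ham) t).coord a = 1 - t := by
    simp [edgePath, edgePoint, ham.ne']
  rw [linkMap]
  split_ifs with h
  · rw [hm]
  · have h0 : (1 - t : ℝ) = 0 := by
      by_contra hne
      exact h ⟨a, Finsupp.mem_support_iff.2 (ha ▸ hne), ham, haA⟩
    rw [← sub_eq_zero.1 h0, AddCircle.coe_period]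

/-- If two elements `a` and `b` in different components below a maximal element `m` can be joined
away from `m`, then the loop through `a`, `m` and `b` is not contractible: the path from `a` to `m`
wraps once around the circle under `linkMap`, and the path from `a` through `b` to `m` is mapped
to a point. -/
theorem not_simplyConnectedSpace_of_zigzagOff {D : Set P} (hD : ∀ m ∈ D, IsMax m)
    {m : P} (hm : m ∈ D) {A : Set P} (hA : IsBelowComponent m A) {a b : P} (ha : a < m)
    (haA : a ∈ A) (hb : b < m) (hbA : b ∉ A) (h : ZigzagOff D a b) :
    ¬ SimplyConnectedSpace (GeometricRealization (orderComplex P)) := by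
  classical
  intro _
  obtain ⟨γ, hγ⟩ := (joinedIn_of_zigzagOff hD hm A h).trans
    (joinedIn_edge A hb hb.ne fun _ => hbA)
  let δ := edgePath (pair_mem_orderComplex ha)
  have hδ (t : unitInterval) : linkMap m A (δ t) = ((t : ℝ) : AddCircle (1 : ℝ)) :=
    linkMap_edgePath ha haA t
  let f : C(GeometricRealization (orderComplex P), AddCircle (1 : ℝ)) :=
    ⟨linkMap m A, linkMap_continuous (hD m hm) hA⟩
  have cov := AddCircle.isCoveringMap_coe (1 : ℝ)
  have hom : (f.comp δ.toContinuousMap).HomotopicRel (f.comp γ.toContinuousMap) {0, 1} :=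
    ContinuousMap.HomotopicRel.comp_continuousMap (SimplyConnectedSpace.paths_homotopic δ γ) f
  have hδ0 : f.comp δ.toContinuousMap 0 = ((0 : ℝ) : AddCircle (1 : ℝ)) := hδ 0
  have hγ0 : f.comp γ.toContinuousMap 0 = ((0 : ℝ) : AddCircle (1 : ℝ)) := hγ 0
  have key := cov.liftPath_apply_one_eq_of_homotopicRel hom 0 hδ0 hγ0
  have e₁ : (⟨fun t => (t : ℝ), continuous_subtype_val⟩ : C(unitInterval, ℝ)) =
      cov.liftPath _ 0 hδ0 :=
    (cov.eq_liftPath_iff' hδ0).2 ⟨funext fun t => (hδ t).symm, rfl⟩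
  have e₂ : ContinuousMap.const unitInterval (0 : ℝ) = cov.liftPath _ 0 hγ0 :=
    (cov.eq_liftPath_iff' hγ0).2 ⟨funext fun t => (hγ t).symm, rfl⟩
  rw [← e₁, ← e₂] at key
  exact one_ne_zero key

end Poset

end GeometricRealization

/-! ### Connectivity of the coset poset away from the cosets of a maximal subgroup -/

namespace CosetPoset

variable {G : Type*} [Group G]

/-- The coset `x • H` of a proper subgroup `H` as an element of the coset poset. -/
def coset (H : Subgroup G) (hH : H ≠ ⊤) (x : G) : CosetPoset G :=
  ⟨x • (H : Set G), H, x, hH, rfl⟩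

/-- The left cosets of `M` as elements of the coset poset. -/
def cosetsOf (M : Subgroup G) : Set (CosetPoset G) :=
  {S | ∃ x : G, S.1 = x • (M : Set G)}

theorem smul_subset_smul_iff {H L : Subgroup G} {x y : G} :
    x • (H : Set G) ⊆ y • (L : Set G) ↔ H ≤ L ∧ y⁻¹ * x ∈ L := by
  constructor
  · intro h
    have h' : ∀ k ∈ H, y⁻¹ * (x * k) ∈ L := fun k hk =>
      (mem_leftCoset_iff y).1 (h (mem_leftCoset x hk))
    have hx : y⁻¹ * x ∈ L := by simpa using h' 1 H.one_mem
    refine ⟨fun k hk => ?_, hx⟩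
    have := h' k hk
    rwa [← mul_assoc, L.mul_mem_cancel_left hx] at this
  · rintro ⟨h, hx⟩ z hz
    rw [mem_leftCoset_iff] at hz ⊢
    have := L.mul_mem hx (h hz)
    rwa [show y⁻¹ * x * (x⁻¹ * z) = y⁻¹ * z by group] at this

theorem isMax_of_mem_cosetsOf {M : Subgroup G} (hM : IsCoatom M) :
    ∀ S ∈ cosetsOf M, IsMax S := by
  rintro ⟨_, hS⟩ ⟨x, rfl⟩ ⟨_, L, y, hL, rfl⟩ h
  obtain ⟨hML, hyx⟩ := smul_subset_smul_iff.1 h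
  obtain rfl : L = M := (hM.le_iff.1 hML).resolve_left hL
  exact smul_subset_smul_iff.2 ⟨le_rfl, by simpa using inv_mem hyx⟩

theorem coset_notMem_cosetsOf {M H : Subgroup G} (hH : H ≠ ⊤) (hMH : ¬ M ≤ H) (x : G) :
    coset H hH x ∉ cosetsOf M := by
  rintro ⟨y, hy⟩
  exact hMH (smul_subset_smul_iff.1 hy.ge).1

theorem zigzagOff_of_le {P : Type*} [PartialOrder P] {D : Set P} {a b : P} (hab : a ≤ b)
    (hb : b ∉ D) : ZigzagOff D a b := by
  rcases hab.eq_or_lt with rfl | h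
  · exact .refl _
  · exact .rel _ _ ⟨h, hb⟩

/-- As `G` is not cyclic, `{x}` and `{x * k}` lie in the coset `x • ⟨k⟩` of a proper subgroup, which
is not a coset of `M` when `k ∉ M`. Since the complement of `M` generates `G`, this connects any two
points. -/
theorem zigzagOff_points (hG : ¬ IsCyclic G) {M : Subgroup G} (hM : M ≠ ⊤)
    (hbot : (⊥ : Subgroup G) ≠ ⊤) (x y : G) : ZigzagOff (cosetsOf M) (coset ⊥ hbot x) (coset ⊥ hbot y) := by
  have step : ∀ x k : G, k ∉ M →
      ZigzagOff (cosetsOf M) (coset ⊥ hbot x) (coset ⊥ hbot (x * k)) := by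
    intro x k hk
    have hH : Subgroup.zpowers k ≠ ⊤ := fun h =>
      hG ((isCyclic_iff_exists_zpowers_eq_top).2 ⟨k, h⟩)
    have hD : coset _ hH x ∉ cosetsOf M := by
      rintro ⟨y, hy⟩
      exact hk ((smul_subset_smul_iff.1 hy.le).1 (Subgroup.mem_zpowers k))
    refine .trans _ _ _ (zigzagOff_of_le (smul_subset_smul_iff.2 ⟨bot_le, ?_⟩) hD)
      (.symm _ _ (zigzagOff_of_le (smul_subset_smul_iff.2 ⟨bot_le, ?_⟩) hD))
    · simp
    · simp
  by_cases hk : x⁻¹ * y ∈ M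
  · obtain ⟨l, hl⟩ : ∃ l, l ∉ M := by
      by_contra! h
      exact hM ((Subgroup.eq_top_iff' M).2 h)
    have hl' : l⁻¹ * (x⁻¹ * y) ∉ M := by rwa [M.mul_mem_cancel_right hk, inv_mem_iff]
    have h := step (x * l) _ hl'
    rw [show x * l * (l⁻¹ * (x⁻¹ * y)) = y by group] at h
    exact .trans _ _ _ (step x l hl) h
  · have h := step x _ hk
    rwa [mul_inv_cancel_left] at h

theorem zigzagOff_of_notMem (hG : ¬ IsCyclic G) {M : Subgroup G} (hM : M ≠ ⊤) {a b : CosetPoset G}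
    (ha : a ∉ cosetsOf M) (hb : b ∉ cosetsOf M) : ZigzagOff (cosetsOf M) a b := by
  have hbot : (⊥ : Subgroup G) ≠ ⊤ := ne_top_of_le_ne_top hM bot_le
  have point_le : ∀ c : CosetPoset G, ∃ x, coset ⊥ hbot x ≤ c := by
    rintro ⟨_, H, x, hH, rfl⟩
    exact ⟨x, smul_subset_smul_iff.2 ⟨bot_le, by simp⟩⟩
  obtain ⟨x, hx⟩ := point_le a
  obtain ⟨y, hy⟩ := point_le b
  exact .trans _ _ _ (.symm _ _ (zigzagOff_of_le hx ha))
    (.trans _ _ _ (zigzagOff_points hG hM hbot x y) (zigzagOff_of_le hy hb))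

/-- If `K` contains every proper subgroup of `M`, then each coset properly contained in a coset of
`M` lies in exactly one coset of `K`. -/
theorem isBelowComponent_coset {M K : Subgroup G} (hM : M ≠ ⊤) (hK : ∀ H < M, H ≤ K) (x u : G) :
    IsBelowComponent (coset M hM x) {S | S.1 ⊆ u • (K : Set G)} := by
  rintro ⟨_, L, z, hL, rfl⟩ ⟨_, H, y, hH, rfl⟩ hab hb
  refine ⟨fun h => ?_, fun h => Set.Subset.trans hab h⟩
  obtain ⟨hHM, hyx⟩ := smul_subset_smul_iff.1 hb.le
  have hHK : H ≤ K := hK H <| lt_of_le_of_ne hHM <| by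
    rintro rfl
    exact hb.not_ge (smul_subset_smul_iff.2 ⟨le_rfl, by simpa using inv_mem hyx⟩)
  have hzy := hHK (smul_subset_smul_iff.1 hab).2
  have hzu := (smul_subset_smul_iff.1 h).2
  refine smul_subset_smul_iff.2 ⟨hHK, ?_⟩
  have := K.mul_mem hzu (K.inv_mem hzy)
  rwa [show u⁻¹ * z * (y⁻¹ * z)⁻¹ = u⁻¹ * y by group] at this

/-! ### The maximal subgroup of a cyclic `p`-group -/

theorem zpow_mem_zpowers_pow_iff {g : G} {p n : ℕ} (hn : n ≠ 0) (hg : orderOf g = p ^ n) (i : ℤ) :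
    g ^ i ∈ Subgroup.zpowers (g ^ p) ↔ (p : ℤ) ∣ i := by
  constructor
  · rintro ⟨k, hk⟩
    have hk : g ^ ((p : ℤ) * k) = g ^ i := by simpa [zpow_mul] using hk
    have h : ((p ^ n : ℕ) : ℤ) ∣ i - p * k := hg ▸ orderOf_dvd_sub_iff_zpow_eq_zpow.2 hk.symm
    have hp : (p : ℤ) ∣ ((p ^ n : ℕ) : ℤ) := Int.natCast_dvd_natCast.2 (dvd_pow_self p hn)
    exact (dvd_sub_left (dvd_mul_right (p : ℤ) k)).1 (hp.trans h)
  · rintro ⟨k, rfl⟩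
    exact ⟨k, by simp [zpow_mul]⟩

theorem le_zpowers_pow_of_lt {g : G} {p n : ℕ} (hp : p.Prime) (hg : orderOf g = p ^ n)
    {H : Subgroup G} (hH : H < Subgroup.zpowers g) : H ≤ Subgroup.zpowers (g ^ p) := by
  intro h hh
  obtain ⟨i, rfl⟩ := hH.le hh
  by_cases hpi : (p : ℤ) ∣ i
  · obtain ⟨k, rfl⟩ := hpi
    exact ⟨k, by simp [zpow_mul]⟩
  · refine absurd (Subgroup.zpowers_le.2 ?_) hH.not_ge
    -- By Bézout, `g` is a power of `g ^ i`, because `i` is prime to the order of `g`.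
    have hcop : IsCoprime i (orderOf g : ℤ) := by
      rw [hg, Nat.cast_pow]
      exact ((Nat.prime_iff_prime_int.1 hp).irreducible.coprime_iff_not_dvd.2 hpi).symm.pow_right
    obtain ⟨a, b, hab⟩ := hcop
    have : (g ^ i) ^ a = g := by
      have hb : g ^ ((orderOf g : ℤ) * b) = 1 := by rw [zpow_mul, zpow_natCast, pow_orderOf_eq_one,
        one_zpow]
      rw [← zpow_mul, ← mul_one (g ^ (i * a)), ← hb, ← zpow_add, mul_comm i, mul_comm _ b, hab,
        zpow_one]
    exact this ▸ H.zpow_mem hh a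

/-- A maximal subgroup of a non-cyclic group is nontrivial, so `n ≠ 0`. -/
theorem exists_generator (hG : ¬ IsCyclic G) {M : Subgroup G} (hM : IsCoatom M) (hMc : IsCyclic M)
    {p n : ℕ} (hcard : Nat.card M = p ^ n) :
    ∃ g : G, M = Subgroup.zpowers g ∧ orderOf g = p ^ n ∧ n ≠ 0 := by
  obtain ⟨g, hg⟩ := (Subgroup.isCyclic_iff_exists_zpowers_eq_top M).1 hMc
  refine ⟨g, hg.symm, by rw [← hcard, ← hg, Nat.card_zpowers], ?_⟩
  rintro rfl
  have hMbot : M = ⊥ := Subgroup.card_eq_one.1 (by simpa using hcard)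
  obtain ⟨k, hk⟩ : ∃ k, k ∉ M := by
    by_contra! h
    exact hM.1 ((Subgroup.eq_top_iff' M).2 h)
  have hlt : M < Subgroup.zpowers k := by
    rw [hMbot, bot_lt_iff_ne_bot, Ne, Subgroup.zpowers_eq_bot]
    rintro rfl
    exact hk M.one_mem
  exact hG (isCyclic_iff_exists_zpowers_eq_top.2 ⟨k, hM.2 _ hlt⟩)

theorem coset_zpow_subset_iff {g : G} {p n : ℕ} (hn : n ≠ 0) (hg : orderOf g = p ^ n) (u : G)
    (i j : ℤ) : (u * g ^ i) • (Subgroup.zpowers (g ^ p) : Set G) ⊆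
      (u * g ^ j) • (Subgroup.zpowers (g ^ p) : Set G) ↔ (p : ℤ) ∣ i - j := by
  rw [smul_subset_smul_iff, ← zpow_mem_zpowers_pow_iff hn hg,
    show (u * g ^ j)⁻¹ * (u * g ^ i) = g ^ (i - j) by group]
  exact and_iff_right le_rfl

end CosetPoset

/-! ### Homology and fundamental group of the coset poset -/

open CosetPoset in
theorem mainTheorem4 {G : Type*} [Group G] (hG : ¬ IsCyclic G)
    (M : Subgroup G) (hM : IsCoatom M) (hMc : IsCyclic M)
    (p n : ℕ) (hp : p.Prime) (hcard : Nat.card M = p ^ n) :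
    ((p - 1 : ℕ) : Cardinal) * Cardinal.mk (G ⧸ M) ≤
        Module.rank ℤ (OrderComplex.Homology (CosetPoset G) 1) ∧
      (Infinite G →
        Cardinal.aleph0 ≤ Module.rank ℤ (OrderComplex.Homology (CosetPoset G) 1)) ∧
      ¬ SimplyConnectedSpace (GeometricRealization (orderComplex (CosetPoset G))) := by
  obtain ⟨g, hMg, hg, hn⟩ := exists_generator hG hM hMc hcard
  have hp2 := hp.two_le
  let K : Subgroup G := Subgroup.zpowers (g ^ p)
  have hKM : K ≤ M := by
    rw [hMg]
    exact Subgroup.zpowers_le.2 (pow_mem (Subgroup.mem_zpowers g) p)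
  have hMK : ¬ M ≤ K := fun h => by
    have h1 : g ^ (1 : ℤ) ∈ K := by
      rw [zpow_one]
      exact h (hMg ▸ Subgroup.mem_zpowers g)
    have := Int.le_of_dvd one_pos ((zpow_mem_zpowers_pow_iff hn hg 1).1 h1)
    omega
  have hK : K ≠ ⊤ := ne_top_of_le_ne_top hM.1 hKM
  have hmax : ∀ H < M, H ≤ K := fun H hH => le_zpowers_pow_of_lt hp hg (hMg ▸ hH)
  have hlt : ∀ (u : G) (i : ℤ), coset K hK (u * g ^ i) < coset M hM.1 u := fun u i => by
    refine lt_of_le_not_ge (smul_subset_smul_iff.2 ⟨hKM, ?_⟩)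
      fun h => hMK (smul_subset_smul_iff.1 h).1
    rw [inv_mul_cancel_left, hMg]
    exact zpow_mem (Subgroup.mem_zpowers g) i
  have hD := isMax_of_mem_cosetsOf hM
  have hmem : ∀ u, coset M hM.1 u ∈ cosetsOf M := fun u => ⟨u, rfl⟩
  have hconn : ∀ x y, ZigzagOff (cosetsOf M) (coset K hK x) (coset K hK y) := fun x y =>
    zigzagOff_of_notMem hG hM.1 (coset_notMem_cosetsOf hK hMK x) (coset_notMem_cosetsOf hK hMK y)
  have hrank : ((p - 1 : ℕ) : Cardinal) * Cardinal.mk (G ⧸ M) ≤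
      Module.rank ℤ (OrderComplex.Homology (CosetPoset G) 1) := by
    -- The cosets of `K` in `u • M` are `u • K`, which serves as base, and the `p - 1` cosets
    -- `(u * g ^ (j + 1)) • K` for `j < p - 1`.
    have h := OrderComplex.mk_prod_le_rank_homology_one (J := Fin (p - 1)) hD
      (fun q : G ⧸ M => coset M hM.1 q.out) (fun q => hmem _)
      (fun q r h => by
        have h' : q.out • (M : Set G) = r.out • (M : Set G) := congrArg Subtype.val h
        rw [leftCoset_eq_iff, ← QuotientGroup.eq] at h'
        simpa using h')
      (fun q j => {S | S.1 ⊆ (q.out * g ^ ((j : ℤ) + 1)) • (K : Set G)})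
      (fun q j => isBelowComponent_coset hM.1 hmax _ _)
      (fun q => coset K hK (q.out * g ^ (0 : ℤ))) (fun q => hlt _ _)
      (fun q j h => by
        have h' := (coset_zpow_subset_iff hn hg _ _ _).1 h
        have := Int.le_of_dvd (by omega) ((dvd_neg (α := ℤ)).2 h')
        omega)
      (fun q j => coset K hK (q.out * g ^ ((j : ℤ) + 1))) (fun q j => hlt _ _)
      (fun q j k => by
        refine (coset_zpow_subset_iff hn hg _ _ _).trans ⟨fun h => ?_, fun h => by simp [h]⟩
        have := Int.eq_zero_of_abs_lt_dvd h (abs_lt.2 ⟨by omega, by omega⟩)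
        omega)
      (fun q j => hconn _ _)
    simpa [mul_comm] using h
  refine ⟨hrank, fun _ => ?_, ?_⟩
  · have : Finite M := Nat.finite_of_card_ne_zero (hcard ▸ (pow_pos hp.pos n).ne')
    have : Infinite (G ⧸ M) := by
      by_contra hfin
      rw [not_infinite_iff_finite] at hfin
      exact not_finite_iff_infinite.2 ‹Infinite G›
        (Finite.of_equiv _ (Subgroup.groupEquivQuotientProdSubgroup (s := M)).symm)
    refine le_trans ?_ hrank
    refine (Cardinal.aleph0_le_mk (G ⧸ M)).trans (Cardinal.le_mul_left ?_)
    exact Nat.cast_ne_zero.2 (by omega)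
  · refine GeometricRealization.not_simplyConnectedSpace_of_zigzagOff hD (hmem 1)
      (isBelowComponent_coset hM.1 hmax 1 (1 * g ^ (0 : ℤ))) (hlt 1 0) (Set.Subset.refl _) (hlt 1 1) ?_
      (hconn _ _)
    intro h
    have := Int.le_of_dvd (by omega) ((coset_zpow_subset_iff hn hg _ _ _).1 h)
    omega
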